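/- Let $H^2$ be the Hardy space on the unit circle, i.e. the closed linear span of $\{e^{in\theta}\}_{n\ge 0}$ in $L^2(S^1)$ (normalized arc length), let $T$ be the shift operator $Te^{in\theta}=e^{i(n+1)\theta}$ on $H^2$, and let $\pi_0(n)=T^n$ for $n\in\mathbb{Z}_+=\{0,1,2,\dots\}$. Let $M$ be a $\pi_0$-extension of $\mathbb{Z}_+$, that is, a semigroup (under composition) of isometric linear operators on $H^2$ such that $\pi_0(n)\in M$ for all $n\in\mathbb{Z}_+$ and $\pi_0(1)A=A\pi_0(1)$ for all $A\in M$. For an inner function $\Phi$ (a function in $H^\infty$ on the circle with $|\Phi|=1$ almost everywhere, functions equal almost everywhere being identified) let $T_\Phi$ be the operator $T_\Phi f=\Phi f$ on $H^2$. Then every $A\in M$ is of the form $A=T_\Phi$ for exactly one inner function $\Phi$, and the following conditions are equivalent: 1. $C^*_{\pi_0}(\mathbb{Z}_+)=C^*_{\pi_0}(M)$, where $C^*_{\pi_0}(\mathbb{Z}_+)$ (the Toeplitz algebra) and $C^*_{\pi_0}(M)$ are the $C^*$-subalgebras of $B(H^2)$ generated by $\pi_0(\mathbb{Z}_+)$ and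 by $M$, respectively; 2. every inner function $\Phi$ with $T_\Phi\in M$ is a finite Blaschke product, i.e. of the form $\Phi(z)=c\prod_{j=1}^{n}\frac{z-a_j}{1-\overline{a_j}z}$ with $n\ge 0$, $|a_j|<1$ and $c\in\mathbb{C}$, $|c|=1$. -/

import Mathlib

open MeasureTheory AddCircle
open scoped ENNReal ComplexConjugate

noncomputable section

namespace Hardy

instance fact_two_pi_pos : Fact (0 < 2 * Real.pi) := ⟨Real.two_pi_pos⟩

/-- The unit circle, parametrized by the angle `θ ∈ ℝ / 2πℤ`; `fourier n` is `e^{inθ}`. -/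
abbrev S1 : Type := AddCircle (2 * Real.pi)

/-- Normalized arc length on the circle. -/
abbrev arc : Measure S1 := haarAddCircle

/-- `L²` of the circle. -/
abbrev L2 : Type := Lp ℂ 2 arc

/-- The Hardy space `H²`: the closed linear span of `e^{inθ}`, `n ≥ 0`, in `L²`. -/
abbrev H2 : Submodule ℂ L2 :=
  (Submodule.span ℂ (Set.range fun n : ℕ => (fourierLp 2 (n : ℤ) : L2))).topologicalClosure

theorem fourierLp_mem_H2 (n : ℕ) : (fourierLp 2 (n : ℤ) : L2) ∈ H2 :=
  Submodule.le_topologicalClosure _ (Submodule.subset_span ⟨n, rfl⟩)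

/-- `f ∈ L²` lies in `H²` iff its Fourier coefficients of negative index vanish. -/
theorem mem_H2_iff (f : L2) : f ∈ H2 ↔ ∀ n : ℤ, n < 0 → fourierCoeff f n = 0 := by
  constructor
  · intro hf n hn
    have hle : H2 ≤ LinearMap.ker (innerSL ℂ (fourierLp 2 n : L2)).toLinearMap := by
      refine Submodule.topologicalClosure_minimal _ ?_
        (ContinuousLinearMap.isClosed_ker (innerSL ℂ (fourierLp 2 n : L2)))
      rw [Submodule.span_le]
      rintro _ ⟨m, rfl⟩
      have h := (orthonormal_fourier (T := 2 * Real.pi)).2 (i := n) (j := (m : ℤ)) (by omega)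
      simpa using h
    have h := hle hf
    rw [← fourierBasis_repr, fourierBasis.repr_apply_apply, coe_fourierBasis]
    simpa using h
  · intro h
    have hs := hasSum_fourier_series_L2 f
    refine (Submodule.isClosed_topologicalClosure _).mem_of_tendsto hs
      (Filter.Eventually.of_forall fun s => Submodule.sum_mem _ fun i _ => ?_)
    rcases lt_or_ge i 0 with hi | hi
    · rw [h i hi, zero_smul]
      exact Submodule.zero_mem _
    · lift i to ℕ using hi
      exact Submodule.smul_mem _ _ (fourierLp_mem_H2 i)

/-- Multiplication by a function of class `L^∞`, as a bounded operator on `L²`. -/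
def mulL2 (φ : Lp ℂ ∞ arc) : L2 →L[ℂ] L2 :=
  (ContinuousLinearMap.mul ℂ ℂ).holderL arc ∞ 2 2 φ

theorem coeFn_mulL2 (φ : Lp ℂ ∞ arc) (f : L2) :
    mulL2 φ f =ᵐ[arc] fun t => φ t * f t :=
  (ContinuousLinearMap.mul ℂ ℂ).coeFn_holder φ f

/-- A function of class `L^∞` whose negative Fourier coefficients vanish (that is, a function of
class `H^∞`) multiplies `H²` into itself. -/
theorem mulL2_mem_H2 (φ : Lp ℂ ∞ arc) (hφ : ∀ n : ℤ, n < 0 → fourierCoeff φ n = 0)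
    {f : L2} (hf : f ∈ H2) : mulL2 φ f ∈ H2 := by
  have hle : H2 ≤ Submodule.comap (mulL2 φ).toLinearMap H2 := by
    refine Submodule.topologicalClosure_minimal _ ?_
      ((Submodule.isClosed_topologicalClosure _).preimage (mulL2 φ).continuous)
    rw [Submodule.span_le]
    rintro _ ⟨m, rfl⟩
    change mulL2 φ (fourierLp 2 (m : ℤ)) ∈ H2
    rw [mem_H2_iff]
    intro n hn
    rw [← hφ (n - m) (by omega)]
    apply integral_congr_ae
    filter_upwards [coeFn_mulL2 φ (fourierLp 2 (m : ℤ)), coeFn_fourierLp 2 (m : ℤ)] with t h1 h2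
    rw [h1, h2, show -(n - (m : ℤ)) = -n + m by ring, fourier_add]
    simp only [smul_eq_mul]
    ring
  exact hle hf

/-- Inner functions, through their boundary values on the circle: functions of class `H^∞`
(essentially bounded, with vanishing Fourier coefficients of negative index), taken up to equality
almost everywhere, which are of modulus one almost everywhere. -/
@[ext]
structure InnerFunction where
  /-- The boundary function. -/
  toLp : Lp ℂ ∞ arc
  fourierCoeff_eq_zero : ∀ n : ℤ, n < 0 → fourierCoeff toLp n = 0
  norm_eq_one : ∀ᵐ t ∂arc, ‖toLp t‖ = 1

/-- The operator `T_Φ f = Φ f` on `H²`, for an inner function `Φ`. -/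
def mulOp (Φ : InnerFunction) : H2 →L[ℂ] H2 :=
  ((mulL2 Φ.toLp).comp H2.subtypeL).codRestrict H2
    fun f => mulL2_mem_H2 Φ.toLp Φ.fourierCoeff_eq_zero f.2

theorem coeFn_mulOp (Φ : InnerFunction) (f : H2) :
    (mulOp Φ f : L2) =ᵐ[arc] fun t => Φ.toLp t * (f : L2) t :=
  coeFn_mulL2 Φ.toLp f

/-- The inner function `z = e^{iθ}`. -/
def innerZ : InnerFunction where
  toLp := fourierLp ∞ 1
  fourierCoeff_eq_zero := by
    intro n hn
    have h : fourierCoeff (fourierLp ∞ 1 : Lp ℂ ∞ arc) n =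
        fourierCoeff (fourierLp 2 1 : L2) n := by
      apply integral_congr_ae
      filter_upwards [coeFn_fourierLp (T := 2 * Real.pi) ∞ 1,
        coeFn_fourierLp (T := 2 * Real.pi) 2 1] with t h1 h2
      rw [h1, h2]
    rw [h]
    exact (mem_H2_iff _).1 (by simpa using fourierLp_mem_H2 1) n hn
  norm_eq_one := by
    filter_upwards [coeFn_fourierLp (T := 2 * Real.pi) ∞ 1] with t h1
    rw [h1, fourier_apply, Circle.norm_coe]

/-- The shift operator on `H²`, that is, multiplication by `e^{iθ}`. -/
def shift : H2 →L[ℂ] H2 := mulOp innerZ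

/-- The shift takes `e^{inθ}` to `e^{i(n+1)θ}`; as a bounded operator on the closed span of these
functions it is determined by this. -/
theorem shift_fourierLp (n : ℕ) :
    shift ⟨fourierLp 2 (n : ℤ), fourierLp_mem_H2 n⟩ =
      ⟨fourierLp 2 ((n + 1 : ℕ) : ℤ), fourierLp_mem_H2 (n + 1)⟩ := by
  apply Subtype.ext
  apply Lp.ext
  filter_upwards [coeFn_mulOp innerZ ⟨fourierLp 2 (n : ℤ), fourierLp_mem_H2 n⟩,
    coeFn_fourierLp (T := 2 * Real.pi) ∞ 1, coeFn_fourierLp (T := 2 * Real.pi) 2 (n : ℤ),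
    coeFn_fourierLp (T := 2 * Real.pi) 2 ((n + 1 : ℕ) : ℤ)] with t h1 h2 h3 h4
  rw [shift, h1, h4]
  change (fourierLp ∞ 1 : Lp ℂ ∞ arc) t * (fourierLp 2 (n : ℤ) : L2) t = _
  rw [h2, h3, mul_comm, ← fourier_add]
  push_cast
  rfl

/-- The representation `π₀(n) = Tⁿ` of the additive semigroup of non-negative integers on `H²`,
where `T` is the shift. -/
def pi0 : Multiplicative ℕ →* (H2 →L[ℂ] H2) := powersHom (H2 →L[ℂ] H2) shift

theorem pi0_apply (n : ℕ) : pi0 (Multiplicative.ofAdd n) = shift ^ n := rfl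

/-- For a representation `π` of the semigroup of non-negative integers by operators on `H`: a
`π`-extension is a semigroup `M` of isometric operators on `H` which contains all `π(n)` and
consists of operators commuting with `π(1)`. -/
structure IsExtension {H : Type*} [NormedAddCommGroup H] [InnerProductSpace ℂ H]
    (π : Multiplicative ℕ →* (H →L[ℂ] H)) (M : Subsemigroup (H →L[ℂ] H)) : Prop where
  isometry : ∀ A ∈ M, Isometry A
  map_mem : ∀ n : ℕ, π (Multiplicative.ofAdd n) ∈ M
  commute : ∀ A ∈ M, π (Multiplicative.ofAdd 1) * A = A * π (Multiplicative.ofAdd 1)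

/-- The (unital) `C*`-algebra of operators generated by a set `S` of bounded operators: the
norm-closure of the `*`-algebra generated by `S`. -/
def cstarGen {H : Type*} [NormedAddCommGroup H] [InnerProductSpace ℂ H] [CompleteSpace H]
    (S : Set (H →L[ℂ] H)) : StarSubalgebra ℂ (H →L[ℂ] H) :=
  (StarAlgebra.adjoin ℂ S).topologicalClosure

/-- The set `M'` of the inner functions `Φ` with `T_Φ ∈ M`. -/
def symbols (M : Subsemigroup (H2 →L[ℂ] H2)) : Set InnerFunction := {Φ | mulOp Φ ∈ M}

/-- The finite product `c ∏ⱼ (z - aⱼ) / (1 - āⱼ z)`. -/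
def blaschkeProd (c : ℂ) {n : ℕ} (a : Fin n → ℂ) (z : ℂ) : ℂ :=
  c * ∏ j, (z - a j) / (1 - conj (a j) * z)

/-- `Φ` is a finite Blaschke product: on the circle it agrees almost everywhere with
`c ∏ⱼ (z - aⱼ) / (1 - āⱼ z)`, with finitely many (possibly no) zeros `aⱼ` in the open unit disc
and a unimodular constant `c`. -/
def InnerFunction.IsFiniteBlaschke (Φ : InnerFunction) : Prop :=
  ∃ (c : ℂ) (n : ℕ) (a : Fin n → ℂ), ‖c‖ = 1 ∧ (∀ j, ‖a j‖ < 1) ∧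
    ∀ᵐ t ∂arc, Φ.toLp t = blaschkeProd c a (fourier 1 t)

end Hardy

end

/-!
The whole argument takes place in the commutant of the shift `T`, and the passage between operators
and functions is made once: an isometry `A` commuting with `T` is multiplication by `g = A 1`, and
since `⟨zᵐ g, zⁿ g⟩ = ⟨zᵐ, zⁿ⟩`, the measure `|g|² dθ` has the Fourier coefficients of `dθ`, so that
`|g| = 1` almost everywhere (`exists_mulOp_eq`). Everything then reduces to
`mulOp_mem_cstarGen_iff`: for `Φ` inner, `T_Φ` lies in the Toeplitz algebra if and only if `Φ` is a
finite Blaschke product. In operator form the latter means `T_Φ q(T) = c p(T)`, where `p` and `q`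
are the numerator and the denominator of the product (`isFiniteBlaschke_iff`).

If this identity holds, then `T_Φ = c p(T) q(T)⁻¹`, and `q(T)` is invertible within the Toeplitz
algebra because each factor `1 - āT` is inverted by a Neumann series
(`IsShift.mem_cstarGen_of_blaschke`).

For the converse, no symbol map is used. As `1 - TT*` has rank one, `T` and `T*` commute modulo the
compact operators, hence so does any pair of elements of the Toeplitz algebra
(`IsShift.isCompactOperator_commutator`). If `A = T_Φ` belongs to it, the projection
`1 - AA* = A*A - AA*` onto `ker A*`, the orthogonal complement of `Φ H²`, is therefore compact, and
`ker A*` has finite dimension (`IsShift.finiteDimensional_ker_star`). This space is invariant under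
`T*`. If it is zero, `A` is unitary and commutes with `T` and `T*`, so it is a unimodular scalar.
Otherwise it contains an eigenvector `k` of `T*`, say `T*k = āk`. The coefficients of `k` form the
square-summable progression `āⁿ`, so `|a| < 1`, and `k` spans the orthogonal complement of the range
of the Blaschke operator `B = (T - a)(1 - āT)⁻¹`. Hence `A = BA'` with `A'` again an isometry
commuting with `T`, and `B` embeds `ker A'*` into the part of `ker A*` orthogonal to `k`. Induction
on the dimension concludes (`IsShift.exists_blaschke_of_finrank`).
-/

noncomputable section

namespace Hardy

open ContinuousLinearMap Polynomial

/-! ### Shift operators and eigenvectors of their adjoints -/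

section Shift

variable {H : Type*} [NormedAddCommGroup H] [InnerProductSpace ℂ H] [CompleteSpace H]

/-- `T` is a unilateral shift of multiplicity one with generating vector `e`: an isometry whose
adjoint annihilates the unit vector `e`, with `e, Te, T²e, …` spanning a dense subspace. -/
structure IsShift (T : H →L[ℂ] H) (e : H) : Prop where
  star_mul_self : star T * T = 1
  star_apply : star T e = 0
  norm_vec : ‖e‖ = 1
  dense : (Submodule.span ℂ (Set.range fun n : ℕ => (T ^ n) e)).topologicalClosure = ⊤

theorem star_mul_self_of_isometry {A : H →L[ℂ] H} (hA : Isometry A) : star A * A = 1 := by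
  rw [star_eq_adjoint]
  exact (ContinuousLinearMap.norm_map_iff_adjoint_comp_self A).1
    (fun x => by simpa using hA.norm_map_of_map_zero (map_zero A) x)

theorem inner_star_left (A : H →L[ℂ] H) (x y : H) : inner ℂ (star A x) y = inner ℂ x (A y) := by
  rw [star_eq_adjoint, adjoint_inner_left]

theorem inner_star_right (A : H →L[ℂ] H) (x y : H) : inner ℂ x (star A y) = inner ℂ (A x) y := by
  rw [star_eq_adjoint, adjoint_inner_right]

theorem norm_apply_of_star_mul_self {A : H →L[ℂ] H} (hA : star A * A = 1) (x : H) :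
    ‖A x‖ = ‖x‖ :=
  (ContinuousLinearMap.norm_map_iff_adjoint_comp_self A).2
    (by rw [← star_eq_adjoint]; exact hA) x

/-- For an isometry `A`, the vector `x - AA*x` is the component of `x` in `ker A*`. -/
theorem star_apply_sub_eq_zero {A : H →L[ℂ] H} (hA : star A * A = 1) (x : H) :
    star A (x - A (star A x)) = 0 := by
  have h : star A (A (star A x)) = star A x := congrArg (fun B : H →L[ℂ] H => B (star A x)) hA
  rw [map_sub, h, sub_self]

namespace IsShift

variable {T : H →L[ℂ] H} {e : H}

theorem clm_ext (hT : IsShift T e) {F : Type*} [NormedAddCommGroup F] [NormedSpace ℂ F]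
    {A B : H →L[ℂ] F} (h : ∀ n : ℕ, A ((T ^ n) e) = B ((T ^ n) e)) : A = B := by
  refine ContinuousLinearMap.ext_on (s := Set.range fun n : ℕ => (T ^ n) e) ?_ ?_
  · rw [Submodule.dense_iff_topologicalClosure_eq_top]
    exact hT.dense
  · rintro _ ⟨n, rfl⟩
    exact h n

theorem eq_zero_of_inner (hT : IsShift T e) {x : H} (h : ∀ n : ℕ, inner ℂ x ((T ^ n) e) = 0) :
    x = 0 := by
  have : innerSL ℂ x = 0 := hT.clm_ext (by simpa using h)
  have h2 : inner ℂ x x = 0 := by simpa using congrArg (fun f : H →L[ℂ] ℂ => f x) this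
  exact inner_self_eq_zero.1 h2

/-- `e` is a separating vector for the commutant of `T`. -/
theorem eq_of_commute (hT : IsShift T e) {A B : H →L[ℂ] H} (hA : Commute T A) (hB : Commute T B)
    (h : A e = B e) : A = B :=
  hT.clm_ext fun n => by
    have h1 := congrArg (fun C : H →L[ℂ] H => C e) (hA.pow_left n).eq
    have h2 := congrArg (fun C : H →L[ℂ] H => C e) (hB.pow_left n).eq
    simp only [mul_apply_eq_comp] at h1 h2
    rw [← h1, ← h2, h]

theorem star_pow_apply {T : H →L[ℂ] H} {μ : ℂ} {x : H} (hx : star T x = μ • x) (n : ℕ) :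
    (star (T ^ n)) x = μ ^ n • x := by
  induction n with
  | zero => simp
  | succ n ih =>
    rw [pow_succ, star_mul, mul_apply_eq_comp, ih, map_smul, hx, smul_smul, pow_succ]

/-- Eigenvectors of the backward shift are determined, up to a scalar, by the eigenvalue: the
coefficients of an eigenvector form a geometric progression. -/
theorem eigenvector_unique (hT : IsShift T e) {μ : ℂ} {x y : H} (hx : star T x = μ • x)
    (hy : star T y = μ • y) : inner ℂ e x • y = inner ℂ e y • x := by
  rw [← sub_eq_zero]
  apply hT.eq_zero_of_inner
  intro n
  have key : ∀ z : H, star T z = μ • z → inner ℂ z ((T ^ n) e) = conj μ ^ n * inner ℂ z e := by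
    intro z hz
    rw [← inner_star_left, star_pow_apply hz, inner_smul_left, map_pow]
  rw [inner_sub_left, inner_smul_left, inner_smul_left, key x hx, key y hy, inner_conj_symm,
    inner_conj_symm]
  ring

theorem inner_ne_zero_of_eigenvector (hT : IsShift T e) {μ : ℂ} {x : H} (hx : star T x = μ • x)
    (h0 : x ≠ 0) : inner ℂ e x ≠ 0 := by
  intro h
  apply h0
  apply hT.eq_zero_of_inner
  intro n
  rw [← inner_star_left, star_pow_apply hx, inner_smul_left, ← inner_conj_symm, h]
  simp

theorem star_pow_mul_pow (hT : IsShift T e) (n : ℕ) : star (T ^ n) * T ^ n = 1 := by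
  induction n with
  | zero => simp
  | succ n ih =>
    rw [pow_succ, star_mul, mul_assoc, ← mul_assoc _ _ T, ih, one_mul, hT.star_mul_self]

theorem orthonormal (hT : IsShift T e) : Orthonormal ℂ fun n : ℕ => (T ^ n) e := by
  constructor
  · intro n
    rw [norm_apply_of_star_mul_self (hT.star_pow_mul_pow n), hT.norm_vec]
  · have key : ∀ m k : ℕ, inner ℂ ((T ^ m) e) ((T ^ (m + (k + 1))) e) = 0 := by
      intro m k
      rw [pow_add, mul_apply_eq_comp, ← inner_star_left,
        ← mul_apply_eq_comp (star (T ^ m)), hT.star_pow_mul_pow, pow_succ',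
        mul_apply_eq_comp, ← inner_star_left, one_apply_eq_self,
        hT.star_apply, inner_zero_left]
    intro i j hij
    rcases lt_or_gt_of_ne hij with h | h
    · obtain ⟨k, rfl⟩ := Nat.exists_eq_add_of_lt h
      exact key i k
    · obtain ⟨k, rfl⟩ := Nat.exists_eq_add_of_lt h
      exact inner_eq_zero_symm.1 (key j k)

/-- The coefficients `μⁿ ⟨e, x⟩` of an eigenvector tend to zero by Bessel's inequality. -/
theorem norm_eigenvalue_lt_one (hT : IsShift T e) {μ : ℂ} {x : H} (hx : star T x = μ • x)
    (h0 : x ≠ 0) : ‖μ‖ < 1 := by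
  have hs := (hT.orthonormal.inner_products_summable x).tendsto_atTop_zero
  have hne := hT.inner_ne_zero_of_eigenvector hx h0
  have hn : ∀ n : ℕ, ‖inner ℂ ((T ^ n) e) x‖ ^ 2 = (‖μ‖ ^ 2) ^ n * ‖inner ℂ e x‖ ^ 2 := by
    intro n
    rw [← inner_star_right, star_pow_apply hx, inner_smul_right, norm_mul, norm_pow]
    ring
  simp only [hn] at hs
  by_contra hμ
  push Not at hμ
  have hpos : 0 < ‖inner ℂ e x‖ ^ 2 := by positivity
  have := (hs.eventually (gt_mem_nhds hpos)).exists
  obtain ⟨n, h⟩ := this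
  have h1 : 1 ≤ (‖μ‖ ^ 2) ^ n := one_le_pow₀ (one_le_pow₀ hμ)
  nlinarith

theorem norm_le_one (hT : IsShift T e) : ‖T‖ ≤ 1 :=
  T.opNorm_le_bound zero_le_one fun x => by
    rw [norm_apply_of_star_mul_self hT.star_mul_self, one_mul]

theorem norm_smul_lt_one (hT : IsShift T e) {a : ℂ} (ha : ‖a‖ < 1) : ‖a • T‖ < 1 := by
  rw [norm_smul]
  nlinarith [norm_nonneg a, norm_nonneg T, hT.norm_le_one]

/-- The operator form of `|z - a| = |1 - āz|` on the unit circle. -/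
theorem norm_sub_smul_apply (hT : IsShift T e) (a : ℂ) (x : H) :
    ‖(T - a • 1) x‖ = ‖(1 - conj a • T) x‖ := by
  have hx := norm_apply_of_star_mul_self hT.star_mul_self x
  rw [← sq_eq_sq₀ (norm_nonneg _) (norm_nonneg _)]
  simp only [sub_apply, smul_apply,
    one_apply_eq_self]
  rw [@norm_sub_sq ℂ, @norm_sub_sq ℂ, norm_smul, norm_smul, hx, RCLike.norm_conj,
    inner_smul_right, inner_smul_right]
  have : RCLike.re (a * inner ℂ (T x) x) = RCLike.re (conj a * inner ℂ x (T x)) := by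
    rw [← inner_conj_symm x (T x), ← map_mul, RCLike.conj_re]
  rw [this]

/-- The elementary Blaschke factor `(z - a) / (1 - āz)` evaluated at the shift: an isometry whose
adjoint annihilates the eigenvectors of `T*` with eigenvalue `ā`. -/
theorem exists_factor (hT : IsShift T e) {a : ℂ} (ha : ‖a‖ < 1) :
    ∃ B : H →L[ℂ] H, Commute T B ∧ star B * B = 1 ∧ B * (1 - conj a • T) = T - a • 1 ∧
      ∀ y, star T y = conj a • y → star B y = 0 := by
  have hu : IsUnit (1 - conj a • T) :=
    isUnit_one_sub_of_norm_lt_one (hT.norm_smul_lt_one (by simpa using ha))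
  obtain ⟨u, hu⟩ := hu
  have hTu : Commute T (u : H →L[ℂ] H) := by
    rw [hu]
    exact (Commute.one_right T).sub_right ((Commute.refl T).smul_right _)
  have hB : (T - a • 1) * (↑u⁻¹ : H →L[ℂ] H) * (1 - conj a • T) = T - a • 1 := by
    rw [mul_assoc, ← hu, Units.inv_mul, mul_one]
  refine ⟨(T - a • 1) * ↑u⁻¹, ?_, ?_, hB, ?_⟩
  · exact ((Commute.refl T).sub_right ((Commute.one_right T).smul_right _)).mul_right
      hTu.units_inv_right
  · apply star_mul_self_of_isometry
    apply AddMonoidHomClass.isometry_of_norm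
    intro x
    rw [mul_apply_eq_comp, hT.norm_sub_smul_apply, ← hu,
      ← mul_apply_eq_comp, Units.mul_inv, one_apply_eq_self]
  · intro y hy
    rw [star_mul, mul_apply_eq_comp, star_sub, star_smul, star_one, sub_apply, smul_apply,
      one_apply_eq_self, hy, starRingEnd_apply, sub_self, map_zero]

end IsShift

end Shift

/-! ### Operators commuting modulo the compact operators -/

section EssCommutant

variable {H : Type*} [NormedAddCommGroup H] [InnerProductSpace ℂ H]

/-- The algebra of the operators which commute with `X` modulo the compact operators. -/
def essCommutant (X : H →L[ℂ] H) : Subalgebra ℂ (H →L[ℂ] H) where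
  carrier := {A | IsCompactOperator (A * X - X * A)}
  mul_mem' := by
    intro A B hA hB
    have h : A * B * X - X * (A * B) = A * (B * X - X * B) + (A * X - X * A) * B := by
      noncomm_ring
    change IsCompactOperator (A * B * X - X * (A * B))
    rw [h]
    exact (hB.clm_comp A).add (hA.comp_clm B)
  add_mem' := by
    intro A B hA hB
    have h : (A + B) * X - X * (A + B) = (A * X - X * A) + (B * X - X * B) := by
      noncomm_ring
    change IsCompactOperator ((A + B) * X - X * (A + B))
    rw [h]
    exact hA.add hB
  algebraMap_mem' := by
    intro r
    change IsCompactOperator (algebraMap ℂ (H →L[ℂ] H) r * X - X * algebraMap ℂ (H →L[ℂ] H) r)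
    rw [Algebra.commutes, sub_self]
    exact isCompactOperator_zero

theorem mem_essCommutant {X A : H →L[ℂ] H} :
    A ∈ essCommutant X ↔ IsCompactOperator (A * X - X * A) := Iff.rfl

theorem mem_essCommutant_comm {X A : H →L[ℂ] H} : A ∈ essCommutant X ↔ X ∈ essCommutant A := by
  suffices ∀ {X A : H →L[ℂ] H}, A ∈ essCommutant X → X ∈ essCommutant A from ⟨this, this⟩
  intro X A h
  rw [mem_essCommutant] at *
  have h' : X * A - A * X = -(A * X - X * A) := by abel
  rw [h']
  exact h.neg

theorem isClosed_essCommutant [CompleteSpace H] (X : H →L[ℂ] H) :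
    IsClosed (essCommutant X : Set (H →L[ℂ] H)) :=
  (isClosed_setOfPred_isCompactOperator (σ₁₂ := RingHom.id ℂ) (M₁ := H) (M₂ := H)).preimage
    (f := fun A : H →L[ℂ] H => A * X - X * A) (by fun_prop)

end EssCommutant

/-! ### Isometries in the commutant of a shift -/

section Shift

variable {H : Type*} [NormedAddCommGroup H] [InnerProductSpace ℂ H] [CompleteSpace H]

/-- The numerator `∏ⱼ (X - aⱼ)` of a finite Blaschke product. -/
def blaschkeNum {n : ℕ} (a : Fin n → ℂ) : ℂ[X] := ∏ j, (X - C (a j))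

/-- The denominator `∏ⱼ (1 - āⱼ X)` of a finite Blaschke product. -/
def blaschkeDen {n : ℕ} (a : Fin n → ℂ) : ℂ[X] := ∏ j, (1 - C (conj (a j)) * X)

namespace IsShift

variable {T : H →L[ℂ] H} {e : H}

/-- A surjective isometry in the commutant of the shift is scalar. -/
theorem eq_smul_one_of_ker_star_eq_bot (hT : IsShift T e) {A : H →L[ℂ] H} (hTA : Commute T A)
    (hA : star A * A = 1) (hker : ∀ x, star A x = 0 → x = 0) : ∃ c : ℂ, ‖c‖ = 1 ∧ A = c • 1 := by
  have hA' : A * star A = 1 := by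
    ext x
    exact (sub_eq_zero.1 (hker _ (star_apply_sub_eq_zero hA x))).symm
  -- As `A* = A⁻¹` also commutes with `T`, the operator `A` commutes with `T*` and preserves
  -- `ker T*`, which is spanned by `e`.
  have hcomm : star T * A = A * star T := by
    have h : star T * star A = star A * star T := by rw [← star_mul, ← star_mul, hTA.eq]
    calc star T * A = A * star A * (star T * A) := by rw [hA', one_mul]
      _ = A * (star A * star T) * A := by noncomm_ring
      _ = A * star T * (star A * A) := by rw [← h]; noncomm_ring
      _ = A * star T := by rw [hA, mul_one]
  have hAe : star T (A e) = (0 : ℂ) • A e := by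
    rw [← mul_apply_eq_comp, hcomm, mul_apply_eq_comp, hT.star_apply, map_zero, zero_smul]
  have he : star T e = (0 : ℂ) • e := by rw [hT.star_apply, zero_smul]
  have hu := hT.eigenvector_unique he hAe
  rw [inner_self_eq_norm_sq_to_K, hT.norm_vec] at hu
  norm_num at hu
  refine ⟨inner ℂ e (A e), ?_, ?_⟩
  · have := congrArg norm hu
    rw [norm_smul, norm_apply_of_star_mul_self hA, hT.norm_vec, mul_one] at this
    exact this.symm
  · exact hT.eq_of_commute hTA ((Commute.one_right T).smul_right _) (by simpa using hu)

/-- If `ker A*` contains an eigenvector `k` of the backward shift `T*`, with eigenvalue `ā`, then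
the Blaschke factor vanishing at `a` divides `A`. -/
theorem exists_factorization (hT : IsShift T e) {A : H →L[ℂ] H} (hTA : Commute T A)
    (hA : star A * A = 1) {a : ℂ} {k : H} (hk : star T k = conj a • k) (hk0 : k ≠ 0)
    (hAk : star A k = 0) :
    ∃ B A' : H →L[ℂ] H, star B * B = 1 ∧ B * (1 - conj a • T) = T - a • 1 ∧ star B k = 0 ∧
      Commute T A' ∧ star A' * A' = 1 ∧ B * A' = A := by
  have ha : ‖a‖ < 1 := by simpa using hT.norm_eigenvalue_lt_one hk hk0
  obtain ⟨B, hTB, hB, hBa, hBk⟩ := hT.exists_factor ha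
  -- By uniqueness of eigenvectors `ker B*` is spanned by `k`, which lies in `ker A*`.
  have hker : ∀ y, star B y = 0 → star A y = 0 := by
    intro y hy
    have hy' : star T y = conj a • y := by
      have h : star (T - a • 1) y = 0 := by
        rw [← hBa, star_mul, mul_apply_eq_comp, hy, map_zero]
      rw [star_sub, star_smul, star_one, sub_apply, smul_apply, one_apply_eq_self] at h
      exact sub_eq_zero.1 h
    have h := congrArg (fun z => star A z) (hT.eigenvector_unique hk hy')
    simp only [map_smul] at h
    rw [hAk, smul_zero] at h
    exact (smul_eq_zero.1 h).resolve_left (hT.inner_ne_zero_of_eigenvector hk hk0)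
  -- The range of `A` lies in the range of `B`, on which the projection `BB*` is the identity.
  have hBA : B * (star B * A) = A := by
    ext x
    have h0 := star_apply_sub_eq_zero hB (A x)
    have h1 := hker _ h0
    symm
    rw [← sub_eq_zero, ← inner_self_eq_zero (𝕜 := ℂ), inner_sub_right]
    simp only [mul_apply_eq_comp]
    rw [← inner_star_left, ← inner_star_left, h0, h1, inner_zero_left, inner_zero_left, sub_zero]
  refine ⟨B, star B * A, hB, hBa, hBk k hk, ?_, ?_, hBA⟩
  · have h : B * (T * (star B * A)) = B * (star B * A * T) := by
      rw [← mul_assoc, ← hTB.eq, mul_assoc, hBA, ← mul_assoc B, hBA, hTA.eq]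
    have h2 := congrArg (star B * ·) h
    simp only [← mul_assoc, hB, one_mul] at h2
    rw [Commute, SemiconjBy, ← mul_assoc, h2]
  · rw [star_mul, star_star, mul_assoc, hBA, hA]

/-- The induction removes one Blaschke factor at a time, each lowering the dimension of the
kernel of the adjoint. -/
theorem exists_blaschke_of_finrank (hT : IsShift T e) (n : ℕ) :
    ∀ A : H →L[ℂ] H, Commute T A → star A * A = 1 →
      FiniteDimensional ℂ (LinearMap.ker (star A : H →L[ℂ] H).toLinearMap) →
      Module.finrank ℂ (LinearMap.ker (star A : H →L[ℂ] H).toLinearMap) = n →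
      ∃ (c : ℂ) (m : ℕ) (a : Fin m → ℂ), ‖c‖ = 1 ∧ (∀ j, ‖a j‖ < 1) ∧
        A * aeval T (blaschkeDen a) = c • aeval T (blaschkeNum a) := by
  induction n using Nat.strong_induction_on with
  | _ n ih =>
  intro A hTA hA hfin hn
  set K := LinearMap.ker (star A : H →L[ℂ] H).toLinearMap with hK
  rcases subsingleton_or_nontrivial K with hsub | hnt
  · obtain ⟨c, hc, rfl⟩ := hT.eq_smul_one_of_ker_star_eq_bot hTA hA fun x hx => by
      have := Subsingleton.elim (⟨x, hx⟩ : K) 0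
      exact congrArg Subtype.val this
    refine ⟨c, 0, Fin.elim0, hc, fun j => j.elim0, ?_⟩
    simp [blaschkeDen, blaschkeNum]
  · have hmaps : ∀ x ∈ K, (star T : H →L[ℂ] H).toLinearMap x ∈ K := by
      intro x hx
      change star A (star T x) = 0
      rw [← mul_apply_eq_comp, ← star_mul, hTA.eq, star_mul, mul_apply_eq_comp,
        show star A x = 0 from hx, map_zero]
    obtain ⟨μ, hμ⟩ := Module.End.exists_eigenvalue
      ((star T : H →L[ℂ] H).toLinearMap.restrict hmaps)
    obtain ⟨k, hk⟩ := hμ.exists_hasEigenvector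
    have hk1 : star T (k : H) = conj (conj μ) • (k : H) := by
      have := congrArg Subtype.val hk.apply_eq_smul
      simpa using this
    have hk0 : (k : H) ≠ 0 := fun h => hk.2 (Subtype.ext h)
    have ha : ‖conj μ‖ < 1 := by simpa using hT.norm_eigenvalue_lt_one hk1 hk0
    obtain ⟨B, A', hB, hBa, hBk, hTA', hA', rfl⟩ :=
      hT.exists_factorization hTA hA hk1 hk0 k.2
    set K' := LinearMap.ker (star A' : H →L[ℂ] H).toLinearMap with hK'
    have hinj : Function.Injective B.toLinearMap := by
      intro x y hxy
      have h := congrArg (fun z => star B z) (show B x = B y from hxy)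
      simpa only [← mul_apply_eq_comp, hB, one_apply_eq_self] using h
    -- `B` maps `ker A'*` into `ker A*`, missing `k` because `B* k = 0`.
    have hlt : K'.map B.toLinearMap < K := by
      refine lt_of_le_of_ne ?_ ?_
      · rintro _ ⟨x, hx, rfl⟩
        change star (B * A') (B x) = 0
        rw [star_mul, mul_apply_eq_comp, ← mul_apply_eq_comp (star B), hB, one_apply_eq_self]
        exact hx
      · intro h
        have hkm : (k : H) ∈ K'.map B.toLinearMap := by
          rw [h]; exact k.2
        obtain ⟨x, -, hx⟩ := hkm
        apply hk0
        have hx' : B x = k := hx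
        have h0 : x = 0 := by
          rw [← hx', ← mul_apply_eq_comp, hB] at hBk
          exact hBk
        rw [← hx', h0, map_zero]
    let E := Submodule.equivMapOfInjective B.toLinearMap hinj K'
    have : FiniteDimensional ℂ (K'.map B.toLinearMap) :=
      Submodule.finiteDimensional_of_le hlt.le
    have hfin' : FiniteDimensional ℂ K' := E.symm.finiteDimensional
    obtain ⟨c, m, a, hc, haj, h⟩ := ih (Module.finrank ℂ K')
      (by rw [← hn, E.finrank_eq]; exact Submodule.finrank_lt_finrank_of_lt hlt)
      A' hTA' hA' hfin' rfl
    refine ⟨c, m + 1, Fin.cons (conj μ) a, hc, ?_, ?_⟩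
    · intro j
      refine Fin.cases ?_ (fun i => ?_) j
      · simpa using ha
      · simpa using haj i
    · have hd : aeval T (1 - C (conj (conj μ)) * X) = 1 - conj (conj μ) • T := by
        simp [Algebra.smul_def]
      have hnu : aeval T (X - C (conj μ)) = T - conj μ • 1 := by
        simp [Algebra.smul_def]
      have hD : blaschkeDen (Fin.cons (conj μ) a : Fin (m + 1) → ℂ) =
          blaschkeDen a * (1 - C (conj (conj μ)) * X) := by
        rw [blaschkeDen, Fin.prod_univ_succ, mul_comm]
        simp only [Fin.cons_zero, Fin.cons_succ]
        rfl
      have hN : blaschkeNum (Fin.cons (conj μ) a : Fin (m + 1) → ℂ) =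
          (X - C (conj μ)) * blaschkeNum a := by
        simp [blaschkeNum, Fin.prod_univ_succ]
      rw [hD, hN, map_mul, map_mul, mul_assoc, ← mul_assoc A', h, hnu, ← hBa, ← hd,
        smul_mul_assoc, mul_smul_comm, mul_assoc, ← map_mul, ← map_mul, mul_comm (blaschkeNum a)]

/-! ### Compactness in the Toeplitz algebra -/

/-- `1 - TT*` has rank one, so the shift is unitary modulo the compact operators. -/
theorem one_sub_mul_star (hT : IsShift T e) :
    1 - T * star T = (toSpanSingleton ℂ e).comp (innerSL ℂ e) := by
  ext x
  have h0 := star_apply_sub_eq_zero hT.star_mul_self x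
  have h := hT.eigenvector_unique (μ := 0) (by rw [hT.star_apply, zero_smul])
    (by rw [h0, zero_smul])
  have he : inner ℂ e (T (star T x)) = 0 := by
    rw [← inner_star_left, hT.star_apply, inner_zero_left]
  rw [inner_self_eq_norm_sq_to_K, hT.norm_vec, inner_sub_right, he] at h
  simpa using h

theorem isCompactOperator_star_mul_sub (hT : IsShift T e) :
    IsCompactOperator (star T * T - T * star T) := by
  rw [hT.star_mul_self, hT.one_sub_mul_star]
  exact (isCompactOperator_of_locallyCompactSpace_rng (toSpanSingleton ℂ e)).comp_clm _

end IsShift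

/-- A closed subalgebra which contains `T` and `T*`, and need not be closed under the adjoint,
contains the `C*`-algebra generated by `T`. -/
theorem mem_of_mem_cstarGen_singleton {T : H →L[ℂ] H} {S : Subalgebra ℂ (H →L[ℂ] H)}
    (hS : IsClosed (S : Set (H →L[ℂ] H))) (h1 : T ∈ S) (h2 : star T ∈ S) {A : H →L[ℂ] H}
    (hA : A ∈ cstarGen {T}) : A ∈ S := by
  have hle : (StarAlgebra.adjoin ℂ {T}).toSubalgebra ≤ S := by
    rw [StarAlgebra.adjoin_toSubalgebra, Algebra.adjoin_le_iff]
    rintro x (hx | hx)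
    · rw [Set.mem_singleton_iff.1 hx]; exact h1
    · rw [Set.star_singleton, Set.mem_singleton_iff] at hx; rw [hx]; exact h2
  exact closure_minimal
    (s := ((StarAlgebra.adjoin ℂ {T} : StarSubalgebra ℂ (H →L[ℂ] H)) : Set (H →L[ℂ] H)))
    hle hS hA

namespace IsShift

variable {T : H →L[ℂ] H} {e : H}

/-- The Toeplitz algebra is commutative modulo the compact operators. -/
theorem isCompactOperator_commutator (hT : IsShift T e) {A B : H →L[ℂ] H}
    (hA : A ∈ cstarGen {T}) (hB : B ∈ cstarGen {T}) : IsCompactOperator (A * B - B * A) := by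
  have hself : ∀ X : H →L[ℂ] H, X ∈ essCommutant X := fun X => by
    rw [mem_essCommutant, sub_self]; exact isCompactOperator_zero
  have hs : star T ∈ essCommutant T := hT.isCompactOperator_star_mul_sub
  refine mem_of_mem_cstarGen_singleton (isClosed_essCommutant B) ?_ ?_ hA <;>
    rw [mem_essCommutant_comm] <;>
    refine mem_of_mem_cstarGen_singleton (isClosed_essCommutant _) ?_ ?_ hB
  · exact hself T
  · exact hs
  · exact mem_essCommutant_comm.1 hs
  · exact hself _

/-- For an isometry `A` in the Toeplitz algebra, the projection `1 - AA* = A*A - AA*` onto `ker A*`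
is compact. -/
theorem finiteDimensional_ker_star (hT : IsShift T e) {A : H →L[ℂ] H} (hA : star A * A = 1)
    (hmem : A ∈ cstarGen {T}) :
    FiniteDimensional ℂ (LinearMap.ker (star A : H →L[ℂ] H).toLinearMap) := by
  have hc := hT.isCompactOperator_commutator (star_mem hmem) hmem
  rw [hA] at hc
  set K := LinearMap.ker (star A : H →L[ℂ] H).toLinearMap with hK
  have hcl : IsClosed (K : Set H) := ContinuousLinearMap.isClosed_ker (star A : H →L[ℂ] H)
  have hid : ∀ x : K, (1 - A * star A) (x : H) = x := by
    intro x
    have hx : star A (x : H) = 0 := x.2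
    rw [sub_apply, mul_apply_eq_comp, hx, map_zero, sub_zero, one_apply_eq_self]
  have h2 := (hc.comp_clm K.subtypeL).codRestrict (V := K)
    (fun x => by
      change (1 - A * star A) (x : H) ∈ K
      rw [hid]; exact x.2) hcl
  refine FiniteDimensional.of_isCompactOperator_id (𝕜 := ℂ) ?_
  exact Eq.mp (congrArg IsCompactOperator (funext fun x => Subtype.ext (hid x))) h2

/-- Isometries of the Toeplitz algebra which commute with `T` are finite Blaschke products in
`T`. -/
theorem exists_blaschke_of_mem_cstarGen (hT : IsShift T e) {A : H →L[ℂ] H} (hTA : Commute T A)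
    (hA : star A * A = 1) (hmem : A ∈ cstarGen {T}) :
    ∃ (c : ℂ) (m : ℕ) (a : Fin m → ℂ), ‖c‖ = 1 ∧ (∀ j, ‖a j‖ < 1) ∧
      A * aeval T (blaschkeDen a) = c • aeval T (blaschkeNum a) :=
  hT.exists_blaschke_of_finrank _ A hTA hA (hT.finiteDimensional_ker_star hA hmem) rfl

/-- The inverse of `q(T)`, for `q` the denominator of a finite Blaschke product, is found inside the
Toeplitz algebra, where the Neumann series of each `1 - āT` converges. -/
theorem mem_cstarGen_of_blaschke (hT : IsShift T e) {A : H →L[ℂ] H} {c : ℂ} {m : ℕ}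
    {a : Fin m → ℂ} (ha : ∀ j, ‖a j‖ < 1)
    (h : A * aeval T (blaschkeDen a) = c • aeval T (blaschkeNum a)) : A ∈ cstarGen {T} := by
  let S := cstarGen {T}
  have hTS : T ∈ S :=
    StarSubalgebra.le_topologicalClosure _ (StarAlgebra.self_mem_adjoin_singleton ℂ T)
  have hS : IsClosed (S : Set (H →L[ℂ] H)) := StarSubalgebra.isClosed_topologicalClosure _
  have : CompleteSpace S := hS.completeSpace_coe
  let t : S := ⟨T, hTS⟩
  have hval : ∀ p : ℂ[X], ((aeval t p : S) : H →L[ℂ] H) = aeval T p := fun p =>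
    (Polynomial.aeval_algHom_apply S.toSubalgebra.val t p).symm
  have hunit : IsUnit (aeval t (blaschkeDen a)) := by
    refine Finset.prod_induction _ (fun p : ℂ[X] => IsUnit (aeval t p))
      (fun p q hp hq => by rw [map_mul]; exact hp.mul hq) (by simp) fun j _ => ?_
    have h1 : aeval t (1 - C (conj (a j)) * X) = 1 - conj (a j) • t := by
      simp [Algebra.smul_def]
    rw [h1]
    apply isUnit_one_sub_of_norm_lt_one
    exact hT.norm_smul_lt_one (a := conj (a j)) (by simpa using ha j)
  obtain ⟨u, hu⟩ := hunit
  have hA : A = ((c • aeval t (blaschkeNum a) * (↑u⁻¹ : S) : S) : H →L[ℂ] H) := by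
    have h1 : (aeval T (blaschkeDen a)) * ((↑u⁻¹ : S) : H →L[ℂ] H) = 1 := by
      rw [← hval, ← hu]
      exact congrArg Subtype.val u.mul_inv
    calc A = A * aeval T (blaschkeDen a) * ((↑u⁻¹ : S) : H →L[ℂ] H) := by
          rw [mul_assoc, h1, mul_one]
      _ = _ := by
          rw [h, ← hval]; rfl
  rw [hA]
  exact Subtype.property _

end IsShift

end Shift

/-! ### The shift on the Hardy space -/

/-- The function `e^{inθ}` as an element of `H²`. -/
def expH2 (n : ℕ) : H2 := ⟨fourierLp 2 (n : ℤ), fourierLp_mem_H2 n⟩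

theorem coeFn_expH2 (n : ℕ) : (expH2 n : L2) =ᵐ[arc] fun t => fourier (n : ℤ) t :=
  coeFn_fourierLp 2 (n : ℤ)

theorem shift_pow_expH2_zero (n : ℕ) : (shift ^ n) (expH2 0) = expH2 n := by
  induction n with
  | zero => rfl
  | succ n ih => rw [pow_succ', mul_apply_eq_comp, ih]; exact shift_fourierLp n

theorem norm_mulOp_apply (Φ : InnerFunction) (f : H2) : ‖mulOp Φ f‖ = ‖f‖ := by
  change ‖(mulOp Φ f : L2)‖ = ‖(f : L2)‖
  rw [Lp.norm_def, Lp.norm_def]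
  congr 1
  apply eLpNorm_congr_norm_ae
  filter_upwards [coeFn_mulOp Φ f, Φ.norm_eq_one] with t h1 h2
  rw [h1, norm_mul, h2, one_mul]

theorem isometry_mulOp (Φ : InnerFunction) : Isometry (mulOp Φ) :=
  AddMonoidHomClass.isometry_of_norm _ (norm_mulOp_apply Φ)

theorem topologicalClosure_span_expH2 :
    (Submodule.span ℂ (Set.range expH2)).topologicalClosure = ⊤ := by
  rw [eq_top_iff]
  rintro x -
  change x ∈ closure ((Submodule.span ℂ (Set.range expH2) : Submodule ℂ H2) : Set H2)
  rw [Topology.IsInducing.subtypeVal.closure_eq_preimage_closure_image]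
  have h : (Subtype.val '' ((Submodule.span ℂ (Set.range expH2) : Submodule ℂ H2) : Set H2)) =
      (Submodule.span ℂ (Set.range fun n : ℕ => (fourierLp 2 (n : ℤ) : L2)) : Set L2) := by
    have h1 := Submodule.map_span H2.subtype (Set.range expH2)
    rw [← Set.range_comp] at h1
    exact congrArg (fun S : Submodule ℂ L2 => (S : Set L2)) h1
  have hx : (x : L2) ∈ closure
    (Submodule.span ℂ (Set.range fun n : ℕ => (fourierLp 2 (n : ℤ) : L2)) : Set L2) := x.2
  rw [← h] at hx
  exact hx

theorem isShift_shift : IsShift shift (expH2 0) where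
  star_mul_self := star_mul_self_of_isometry (isometry_mulOp innerZ)
  norm_vec := (orthonormal_fourier (T := 2 * Real.pi)).1 0
  dense := by
    simp only [shift_pow_expH2_zero]
    exact topologicalClosure_span_expH2
  star_apply := by
    have h : (innerSL ℂ (expH2 0)).comp shift = 0 := by
      refine ContinuousLinearMap.ext_on (s := Set.range expH2) ?_ ?_
      · rw [Submodule.dense_iff_topologicalClosure_eq_top]
        exact topologicalClosure_span_expH2
      · rintro _ ⟨n, rfl⟩
        have h1 : shift (expH2 n) = expH2 (n + 1) := shift_fourierLp n
        rw [comp_apply, h1]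
        exact (orthonormal_fourier (T := 2 * Real.pi)).2 (i := 0) (j := ((n + 1 : ℕ) : ℤ))
          (by omega)
    rw [← inner_self_eq_zero (𝕜 := ℂ), inner_star_left]
    exact congrArg (fun f : H2 →L[ℂ] ℂ => f (star shift (expH2 0))) h

/-- `p(T)` is multiplication by the polynomial `p`. -/
theorem coeFn_aeval_shift (p : ℂ[X]) (f : H2) :
    (aeval shift p f : L2) =ᵐ[arc] fun t => p.eval (fourier 1 t) * (f : L2) t := by
  induction p using Polynomial.induction_on' generalizing f with
  | add p q hp hq =>
    rw [map_add]
    filter_upwards [hp f, hq f, Lp.coeFn_add (aeval shift p f : L2) (aeval shift q f : L2)] with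
      t h1 h2 h3
    rw [eval_add, add_mul, ← h1, ← h2]
    exact h3
  | monomial n c =>
    have hpow : ∀ n : ℕ, ∀ᵐ t ∂arc, ((shift ^ n) f : L2) t = fourier 1 t ^ n * (f : L2) t := by
      intro n
      induction n with
      | zero => simp
      | succ n ih =>
        filter_upwards [ih, coeFn_mulOp innerZ ((shift ^ n) f),
          coeFn_fourierLp (T := 2 * Real.pi) ∞ 1] with t h1 h2 h3
        rw [pow_succ' shift, mul_apply_eq_comp]
        change (mulOp innerZ ((shift ^ n) f) : L2) t = _
        rw [h2, h1]
        change (fourierLp ∞ 1 : Lp ℂ ∞ arc) t * _ = _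
        rw [h3]
        ring
    rw [aeval_monomial, ← Algebra.smul_def]
    filter_upwards [hpow n, Lp.coeFn_smul c ((shift ^ n) f : L2)] with t h1 h2
    rw [eval_monomial, mul_assoc, ← h1]
    exact h2

theorem coeFn_mulOp_expH2_zero (Φ : InnerFunction) :
    (mulOp Φ (expH2 0) : L2) =ᵐ[arc] Φ.toLp := by
  filter_upwards [coeFn_mulOp Φ (expH2 0), coeFn_expH2 0] with t h1 h2
  rw [h1, h2]
  simp

theorem mulOp_injective : Function.Injective mulOp := by
  intro Φ Ψ h
  ext1
  apply Lp.ext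
  filter_upwards [coeFn_mulOp_expH2_zero Φ, coeFn_mulOp_expH2_zero Ψ] with t h1 h2
  rw [← h1, ← h2, h]

theorem commute_shift_mulOp (Φ : InnerFunction) : Commute shift (mulOp Φ) := by
  ext1 f
  apply Subtype.ext
  apply Lp.ext
  filter_upwards [coeFn_mulOp innerZ (mulOp Φ f), coeFn_mulOp innerZ f,
    coeFn_mulOp Φ (shift f), coeFn_mulOp Φ f] with t h1 h2 h3 h4
  change (mulOp innerZ (mulOp Φ f) : L2) t = (mulOp Φ (shift f) : L2) t
  rw [h1, h3, h4]
  change _ = _ * (mulOp innerZ f : L2) t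
  rw [h2]
  ring

/-! ### Isometries commuting with the shift are multiplications by inner functions -/

/-- A finite measure on the circle is determined by its Fourier coefficients, since trigonometric
polynomials are dense in the continuous functions. -/
theorem measure_eq_arc_of_integral_fourier {ν : Measure S1} [IsFiniteMeasure ν]
    (h : ∀ n : ℤ, ∫ t, fourier n t ∂ν = ∫ t, fourier n t ∂arc) : ν = arc := by
  have hc : ∀ (μ : Measure S1) [IsFiniteMeasure μ],
      Continuous fun f : C(S1, ℂ) => ∫ t, f t ∂μ := by
    intro μ _
    refine (continuous_integral.comp (ContinuousMap.toLp (E := ℂ) 1 μ ℂ).continuous).congr ?_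
    intro f
    exact integral_congr_ae (ContinuousMap.coeFn_toLp μ f)
  have hi : ∀ (μ : Measure S1) [IsFiniteMeasure μ] (f : C(S1, ℂ)), Integrable f μ :=
    fun μ _ f => f.continuous.integrable_of_hasCompactSupport (HasCompactSupport.of_compactSpace f)
  have hall : ∀ f : C(S1, ℂ), ∫ t, f t ∂ν = ∫ t, f t ∂arc := by
    intro f
    have hf : f ∈ (Submodule.span ℂ (Set.range (@fourier (2 * Real.pi)))).topologicalClosure := by
      rw [span_fourier_closure_eq_top]; trivial
    refine closure_minimal (t := {f : C(S1, ℂ) | ∫ t, f t ∂ν = ∫ t, f t ∂arc}) ?_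
      (isClosed_eq (hc ν) (hc arc)) hf
    intro g hg
    induction hg using Submodule.span_induction with
    | mem x hx => obtain ⟨n, rfl⟩ := hx; exact h n
    | zero => simp
    | add x y _ _ hx hy =>
      simp only [Set.mem_ofPred_eq, ContinuousMap.add_apply] at *
      rw [integral_add (hi ν x) (hi ν y), integral_add (hi arc x) (hi arc y), hx, hy]
    | smul c x _ hx =>
      simp only [Set.mem_ofPred_eq, ContinuousMap.smul_apply] at *
      rw [integral_smul, integral_smul, hx]
  refine ext_of_forall_integral_eq_of_IsFiniteMeasure fun f => ?_
  have hf := hall ⟨fun t => (f t : ℂ), by fun_prop⟩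
  simp only [ContinuousMap.coe_mk, integral_complex_ofReal] at hf
  exact_mod_cast hf

/-- The hypothesis says that the measure with density `|g|²` has the Fourier coefficients of
arc length. -/
theorem ae_norm_eq_one_of_integral_fourier {g : S1 → ℂ} (hg : MemLp g 2 arc)
    (h : ∀ n : ℤ, ∫ t, (‖g t‖ ^ 2 : ℝ) • (fourier n t : ℂ) ∂arc = ∫ t, (fourier n t : ℂ) ∂arc) :
    ∀ᵐ t ∂arc, ‖g t‖ = 1 := by
  have hm : AEMeasurable (fun t => ‖g t‖ₑ ^ 2) arc := hg.1.enorm.pow_const 2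
  have hlt : ∫⁻ t, ‖g t‖ₑ ^ 2 ∂arc ≠ ∞ := by
    have := (hg.integrable_norm_pow (by norm_num)).2
    simpa [HasFiniteIntegral, enorm_pow] using this.ne
  let ν := arc.withDensity fun t => ‖g t‖ₑ ^ 2
  have : IsFiniteMeasure ν := isFiniteMeasure_withDensity hlt
  have hν : ν = arc := by
    apply measure_eq_arc_of_integral_fourier
    intro n
    rw [← h n, integral_withDensity_eq_integral_toReal_smul₀ hm (ae_lt_top' hm hlt)]
    simp
  have h1 := (withDensity_eq_iff hm (g := 1) aemeasurable_const hlt).1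
    (by rw [withDensity_one]; exact hν)
  filter_upwards [h1] with t ht
  have h2 := congrArg ENNReal.toReal ht
  have h3 : ‖g t‖ = 1 ∨ ‖g t‖ = -1 := by simpa using h2
  exact h3.resolve_right fun h => by linarith [norm_nonneg (g t)]

theorem coeFn_commutant_apply_expH2 {A : H2 →L[ℂ] H2} (hA : Commute shift A) (n : ℕ) :
    (A (expH2 n) : L2) =ᵐ[arc] fun t => fourier (n : ℤ) t * (A (expH2 0) : L2) t := by
  have h : A (expH2 n) = aeval shift (X ^ n : ℂ[X]) (A (expH2 0)) := by
    rw [← shift_pow_expH2_zero n, ← mul_apply_eq_comp, ← (hA.pow_left n).eq, mul_apply_eq_comp,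
      map_pow, aeval_X]
  rw [h]
  filter_upwards [coeFn_aeval_shift (X ^ n) (A (expH2 0))] with t ht
  rw [ht, eval_pow, eval_X, fourier_apply, fourier_apply, one_zsmul, natCast_zsmul, toCircle_nsmul,
    Circle.coe_pow]

/-- Isometries commuting with the shift are multiplications by inner functions: if `g = A 1`, then
`A zⁿ = zⁿ g`, and preservation of inner products says that `|g|²` has the Fourier coefficients of
the constant `1`. -/
theorem exists_mulOp_eq {A : H2 →L[ℂ] H2} (hiso : Isometry A) (hA : Commute shift A) :
    ∃ Φ : InnerFunction, mulOp Φ = A := by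
  set g : L2 := (A (expH2 0) : L2) with hg
  have hAA := star_mul_self_of_isometry hiso
  have hin : ∀ x y : H2, inner ℂ (A x) (A y) = inner ℂ x y := by
    intro x y
    rw [← inner_star_left, ← mul_apply_eq_comp, hAA, one_apply_eq_self]
  have hnat : ∀ m n : ℕ, ∫ t, (‖g t‖ ^ 2 : ℝ) • (fourier ((n : ℤ) - m) t : ℂ) ∂arc =
      ∫ t, (fourier ((n : ℤ) - m) t : ℂ) ∂arc := by
    intro m n
    have h1 := hin (expH2 m) (expH2 n)
    rw [Submodule.coe_inner, Submodule.coe_inner, L2.inner_def, L2.inner_def] at h1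
    convert h1 using 1
    · apply integral_congr_ae
      filter_upwards [coeFn_commutant_apply_expH2 hA m, coeFn_commutant_apply_expH2 hA n] with
        t h1 h2
      rw [h1, h2, sub_eq_add_neg, fourier_add, fourier_neg, RCLike.inner_apply, map_mul,
        Complex.real_smul]
      push_cast
      rw [← Complex.conj_mul']
      ring
    · apply integral_congr_ae
      filter_upwards [coeFn_expH2 m, coeFn_expH2 n] with t h1 h2
      rw [h1, h2, sub_eq_add_neg, fourier_add, fourier_neg, RCLike.inner_apply]
  have hnorm : ∀ᵐ t ∂arc, ‖g t‖ = 1 := by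
    refine ae_norm_eq_one_of_integral_fourier (Lp.memLp g) fun n => ?_
    -- Write `n` as a difference of its positive and negative parts.
    have := hnat (-n).toNat n.toNat
    rwa [show ((n.toNat : ℤ) - ((-n).toNat : ℤ)) = n by omega] at this
  have hbdd : MemLp g ∞ arc :=
    memLp_top_of_bound (Lp.aestronglyMeasurable g) 1 (hnorm.mono fun t ht => ht.le)
  refine ⟨⟨hbdd.toLp g, ?_, ?_⟩, ?_⟩
  · intro n hn
    rw [fourierCoeff_congr_ae hbdd.coeFn_toLp]
    exact (mem_H2_iff g).1 (A (expH2 0)).2 n hn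
  · filter_upwards [hbdd.coeFn_toLp, hnorm] with t h1 h2
    rw [h1, h2]
  · refine isShift_shift.eq_of_commute (commute_shift_mulOp _) hA ?_
    apply Subtype.ext
    apply Lp.ext
    exact (coeFn_mulOp_expH2_zero _).trans hbdd.coeFn_toLp

theorem star_mulOp_mul_mulOp (Φ : InnerFunction) : star (mulOp Φ) * mulOp Φ = 1 :=
  star_mul_self_of_isometry (isometry_mulOp Φ)

/-! ### Finite Blaschke products and the Toeplitz algebra -/

/-- The algebraic form of the condition that `Φ` is a finite Blaschke product: `T_Φ q(T) = c p(T)`,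
where `p` and `q` are the numerator and the denominator. -/
theorem isFiniteBlaschke_iff (Φ : InnerFunction) : Φ.IsFiniteBlaschke ↔
    ∃ (c : ℂ) (n : ℕ) (a : Fin n → ℂ), ‖c‖ = 1 ∧ (∀ j, ‖a j‖ < 1) ∧
      mulOp Φ * aeval shift (blaschkeDen a) = c • aeval shift (blaschkeNum a) := by
  unfold InnerFunction.IsFiniteBlaschke
  refine exists_congr fun c => exists_congr fun n => exists_congr fun a =>
    and_congr_right fun hc => and_congr_right fun ha => ?_
  have hden : ∀ t : S1, (blaschkeDen a).eval (fourier 1 t : ℂ) ≠ 0 := by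
    intro t
    rw [blaschkeDen, eval_prod, Finset.prod_ne_zero_iff]
    intro j _ h
    rw [eval_sub, eval_one, eval_mul, eval_C, eval_X, sub_eq_zero] at h
    have h1 := congrArg norm h
    rw [norm_one, norm_mul, fourier_apply, Circle.norm_coe, mul_one, RCLike.norm_conj] at h1
    exact (ha j).ne h1.symm
  have hB : ∀ t : S1, blaschkeProd c a (fourier 1 t) =
      c * (blaschkeNum a).eval (fourier 1 t : ℂ) / (blaschkeDen a).eval (fourier 1 t : ℂ) := by
    intro t
    rw [blaschkeProd, Finset.prod_div_distrib, mul_div_assoc]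
    simp [blaschkeNum, blaschkeDen, eval_prod]
  have hL := coeFn_mulOp Φ (aeval shift (blaschkeDen a) (expH2 0))
  have hR := Lp.coeFn_smul c (aeval shift (blaschkeNum a) (expH2 0) : L2)
  have h1 := coeFn_aeval_shift (blaschkeDen a) (expH2 0)
  have h2 := coeFn_aeval_shift (blaschkeNum a) (expH2 0)
  have h0 := coeFn_expH2 0
  constructor
  · intro h
    have hcomm : ∀ p : ℂ[X], Commute shift (aeval shift p) := fun p => by
      simpa only [aeval_X] using (Commute.all X p).map (aeval shift)
    -- Both sides commute with the shift, so it suffices to compare them at the function `1`.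
    refine isShift_shift.eq_of_commute ((commute_shift_mulOp Φ).mul_right (hcomm _))
      (by rw [← map_smul]; exact hcomm _) ?_
    apply Subtype.ext
    apply Lp.ext
    refine hL.trans (Filter.EventuallyEq.trans ?_ hR.symm)
    filter_upwards [h, h1, h2, h0] with t ht h1 h2 h0
    rw [Pi.smul_apply, h1, h2, ht, hB, smul_eq_mul]
    rw [← mul_assoc, div_mul_cancel₀ _ (hden t), mul_assoc]
  · intro h
    have hx : mulOp Φ (aeval shift (blaschkeDen a) (expH2 0)) =
        c • aeval shift (blaschkeNum a) (expH2 0) := by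
      rw [← mul_apply_eq_comp, h]
      rfl
    have hx' : (mulOp Φ (aeval shift (blaschkeDen a) (expH2 0)) : L2) =ᵐ[arc]
        (c • (aeval shift (blaschkeNum a) (expH2 0) : L2) : L2) := by
      rw [hx]
      rfl
    filter_upwards [hL, hR, h1, h2, h0, hx'] with t hL hR h1 h2 h0 hx
    rw [hL, hR, Pi.smul_apply, h1, h2, h0] at hx
    rw [hB, eq_div_iff (hden t)]
    simpa [mul_assoc] using hx

/-- An inner function is a finite Blaschke product if and only if multiplication by it belongs to
the Toeplitz algebra. -/
theorem mulOp_mem_cstarGen_iff (Φ : InnerFunction) :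
    mulOp Φ ∈ cstarGen {shift} ↔ Φ.IsFiniteBlaschke := by
  rw [isFiniteBlaschke_iff]
  constructor
  · exact isShift_shift.exists_blaschke_of_mem_cstarGen (commute_shift_mulOp Φ)
      (star_mulOp_mul_mulOp Φ)
  · rintro ⟨c, n, a, -, ha, h⟩
    exact isShift_shift.mem_cstarGen_of_blaschke ha h

section Gen

variable {H : Type*} [NormedAddCommGroup H] [InnerProductSpace ℂ H] [CompleteSpace H]

theorem subset_cstarGen (S : Set (H →L[ℂ] H)) : S ⊆ cstarGen S := fun _ hx =>
  StarSubalgebra.le_topologicalClosure _ (StarAlgebra.subset_adjoin ℂ S hx)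

theorem cstarGen_le_iff {S S' : Set (H →L[ℂ] H)} : cstarGen S ≤ cstarGen S' ↔ S ⊆ cstarGen S' :=
  ⟨fun h => (subset_cstarGen S).trans h, fun h =>
    StarSubalgebra.topologicalClosure_minimal (StarAlgebra.adjoin_le h)
      (StarSubalgebra.isClosed_topologicalClosure _)⟩

end Gen

theorem cstarGen_range_pi0 : cstarGen (Set.range pi0) = cstarGen {shift} := by
  apply le_antisymm <;> rw [cstarGen_le_iff]
  · rintro _ ⟨n, rfl⟩
    exact pow_mem (subset_cstarGen {shift} rfl) n.toAdd
  · rw [Set.singleton_subset_iff]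
    exact subset_cstarGen _ ⟨Multiplicative.ofAdd 1, by rw [pi0_apply, pow_one]⟩

end Hardy

end

theorem mainTheorem3 (M : Subsemigroup (Hardy.H2 →L[ℂ] Hardy.H2))
    (hM : Hardy.IsExtension Hardy.pi0 M) :
    (∀ A ∈ M, ∃! Φ : Hardy.InnerFunction, Hardy.mulOp Φ = A) ∧
    (Hardy.cstarGen (Set.range Hardy.pi0) = Hardy.cstarGen (M : Set (Hardy.H2 →L[ℂ] Hardy.H2)) ↔
      ∀ Φ ∈ Hardy.symbols M, Φ.IsFiniteBlaschke) := by
  have hrep : ∀ A ∈ M, ∃ Φ : Hardy.InnerFunction, Hardy.mulOp Φ = A := by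
    intro A hA
    refine Hardy.exists_mulOp_eq (hM.isometry A hA) ?_
    have h := hM.commute A hA
    rwa [Hardy.pi0_apply, pow_one] at h
  refine ⟨fun A hA => ?_, ?_⟩
  · obtain ⟨Φ, rfl⟩ := hrep A hA
    exact ⟨Φ, rfl, fun Ψ h => Hardy.mulOp_injective h⟩
  constructor
  · intro h Φ hΦ
    rw [← Hardy.mulOp_mem_cstarGen_iff, ← Hardy.cstarGen_range_pi0, h]
    exact Hardy.subset_cstarGen _ hΦ
  · intro h
    apply le_antisymm <;> rw [Hardy.cstarGen_le_iff]
    · rintro _ ⟨n, rfl⟩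
      exact Hardy.subset_cstarGen _ (hM.map_mem n.toAdd)
    · intro A hA
      obtain ⟨Φ, rfl⟩ := hrep A hA
      rw [Hardy.cstarGen_range_pi0]
      exact (Hardy.mulOp_mem_cstarGen_iff Φ).2 (h Φ hA)
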